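/- Let $q$ be a prime and let $G=(V,\Gamma)$ be a $q$-multigraph: $V$ is a finite set and $\Gamma:V\times V\to\mathbb F_q$ is symmetric with zero diagonal. Let $d\in V$ (the dealer) and let $B\subseteq V\setminus\{d\}$ be a set of players. Put $\omega=e^{2\pi i/q}$ and let $$|G\setminus d\rangle=\frac1{\sqrt{q^{|V|-1}}}\sum_{x\in\mathbb F_q^{V\setminus\{d\}}}\omega^{\sum_{\{u,v\}}x_u\Gamma(u,v)x_v}\,|x\rangle$$ be the graph state of $G$ with $d$ removed, the exponent being summed over the unordered pairs of distinct vertices of $V\setminus\{d\}$. The QQ encoding sends a quantum secret $|\phi\rangle=\sum_{j\in\mathbb F_q}s_j|j\rangle\in\mathbb C^q$ to the state $$|\phi_L\rangle=\sum_{j\in\mathbb F_q}s_j\,Z_{\Gamma.\{d\}}^{\,j}\,|G\setminus d\rangle,\qquad Z_{\Gamma.\{d\}}|x\rangle=\omega^{\sum_{v}\Gamma(v,d)x_v}|x\rangle,$$ of one qudit for each player in $V\setminus\{d\}$ (this map is an isometry when $d$ is not isolated). The set $B$ can recover a quantum secret if there is a quantum channel (completely positive trace-preserving map) $\Phi$ from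 the qudits of $B$ to one qudit, not depending on the secret, such that $$\Phi\bigl(\mathrm{Tr}_{V\setminus(B\cup\{d\})}|\phi_L\rangle\langle\phi_L|\bigr)=|\phi\rangle\langle\phi|\quad\text{for every unit vector }|\phi\rangle\in\mathbb C^q.$$ For $A\subseteq V$ let $\mathrm{cutrk}_G(A)$ be the rank over $\mathbb F_q$ of the submatrix of $\Gamma$ whose columns are indexed by $A$ and rows by $V\setminus A$. Then $B$ can recover a quantum secret in the QQ encoding if and only if $$\partial_d\,\mathrm{cutrk}_G(B):=\mathrm{cutrk}_G(B\cup\{d\})-\mathrm{cutrk}_G(B)=-1 .$$ -/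

import Mathlib

open scoped Matrix

noncomputable section

/-- An (undirected, simple) `q`-multigraph with vertex set `V`: a symmetric adjacency matrix over
`𝔽_q` with zero diagonal; `Γ u v` is the multiplicity of the edge `uv`. -/
structure QMultigraph (q : ℕ) (V : Type*) where
  Γ : Matrix V V (ZMod q)
  symm : ∀ u v, Γ u v = Γ v u
  loopless : ∀ u, Γ u u = 0

namespace QMultigraph

variable {q : ℕ} {V : Type*}

/-- `G \ d`: the multigraph obtained by removing the vertex `d` and its incident edges. -/
def delete (G : QMultigraph q V) (d : V) : QMultigraph q {v : V // v ≠ d} where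
  Γ := G.Γ.submatrix Subtype.val Subtype.val
  symm u v := G.symm u v
  loopless u := G.loopless u

/-- The rank over `𝔽_q` of `Γ[A,B]`, the submatrix of `Γ` with columns in `A` and rows in `B`. -/
def prk (G : QMultigraph q V) (A B : Finset V) : ℕ :=
  (G.Γ.submatrix (fun u : {v // v ∈ B} => (u : V)) (fun u : {v // v ∈ A} => (u : V))).rank

/-- The cut rank of `B`: the rank of the matrix of the edges between `B` and `V \ B`. -/
def cutrk [Fintype V] [DecidableEq V] (G : QMultigraph q V) (B : Finset V) : ℕ :=
  G.prk B Bᶜ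

/-- The discrete derivative of the cut rank at `B` with respect to `d`. -/
def dcutrk [Fintype V] [DecidableEq V] (G : QMultigraph q V) (d : V) (B : Finset V) : ℤ :=
  (G.cutrk (insert d B) : ℤ) - (G.cutrk B : ℤ)

/-- The number (mod `q`) `|G[x]|` of edges of the sub-multigraph induced by the multiset `x`:
the sum over the unordered pairs `{u, v}` of the multiplicities `x u * Γ u v * x v`
(the degenerate pairs contribute `0`, as `Γ u u = 0`). -/
def edgeCount [Fintype V] [DecidableEq V] (G : QMultigraph q V) (x : V → ZMod q) : ZMod q :=
  ∑ e : Sym2 V, Sym2.lift ⟨fun u v => x u * G.Γ u v * x v, fun u v => by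
    simp only [G.symm u v]; ring⟩ e

/-- The qudit graph state `|G⟩ = q^{-n/2} ∑_x ω^{|G[x]|} |x⟩`, as its vector of amplitudes in the
computational basis. Here `ZMod.stdAddChar a = ω ^ a` with `ω = exp (2πi/q)`. -/
def graphState [NeZero q] [Fintype V] [DecidableEq V] (G : QMultigraph q V) :
    (V → ZMod q) → ℂ :=
  fun x => ((1 / Real.sqrt ((q : ℝ) ^ Fintype.card V) : ℝ) : ℂ) * ZMod.stdAddChar (G.edgeCount x)

end QMultigraph

/-- The operator `Z_D = ⨂_v Z_v^{D v}` on the qudits indexed by `W`, where `Z |b⟩ = ω^b |b⟩`: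
it maps `|x⟩` to `ω^{∑_v D v * x v} |x⟩`. -/
def pauliZ {q : ℕ} [NeZero q] {W : Type*} [Fintype W] [DecidableEq W] (D : W → ZMod q) :
    Matrix (W → ZMod q) (W → ZMod q) ℂ :=
  Matrix.diagonal fun x => ZMod.stdAddChar (∑ v, D v * x v)

/-- `|j_L⟩ = Z_{Γ.{d}}^j |G \ d⟩`, a state of the qudits of the players `V \ {d}`. -/
def encodedBasis {q : ℕ} [NeZero q] {V : Type*} [Fintype V] [DecidableEq V]
    (G : QMultigraph q V) (d : V) (j : ZMod q) : ({v : V // v ≠ d} → ZMod q) → ℂ :=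
  (pauliZ (fun v : {v : V // v ≠ d} => G.Γ v d) ^ j.val) *ᵥ (G.delete d).graphState

/-- The QQ encoding `|φ_L⟩ = ∑_j s_j |j_L⟩` of the quantum secret `|φ⟩ = ∑_j s_j |j⟩`. -/
def qqEncode {q : ℕ} [NeZero q] {V : Type*} [Fintype V] [DecidableEq V]
    (G : QMultigraph q V) (d : V) (s : ZMod q → ℂ) : ({v : V // v ≠ d} → ZMod q) → ℂ :=
  ∑ j : ZMod q, s j • encodedBasis G d j

/-- The rank-one operator `|ψ⟩⟨ψ|`. -/
def pureDensity {ι : Type*} (ψ : ι → ℂ) : Matrix ι ι ℂ :=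
  Matrix.vecMulVec ψ (star ψ)

/-- The reduced operator on the qudits in `B` of an operator `ρ` on the qudits indexed by `W`:
the partial trace over the qudits outside `B`. -/
def reducedDensity {q : ℕ} [NeZero q] {W : Type*} [Fintype W] [DecidableEq W] (B : Finset W)
    (ρ : Matrix (W → ZMod q) (W → ZMod q) ℂ) :
    Matrix ({w // w ∈ B} → ZMod q) ({w // w ∈ B} → ZMod q) ℂ :=
  fun x y => ∑ z : {w // ¬ w ∈ B} → ZMod q,
    ρ ((Equiv.piEquivPiSubtypeProd (fun w => w ∈ B) (fun _ => ZMod q)).symm (x, z))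
      ((Equiv.piEquivPiSubtypeProd (fun w => w ∈ B) (fun _ => ZMod q)).symm (y, z))

/-- Quantum channels (deterministic quantum operations, i.e. completely positive trace preserving
maps) between finite-dimensional systems with orthonormal bases indexed by `m` and `n`, through the
operator-sum representation `Φ ρ = ∑ i, K i ρ (K i)†` with `∑ i, (K i)† K i = 1`. -/
def IsQuantumChannel {m n : Type*} [Fintype m] [DecidableEq m] [Fintype n]
    (Φ : Matrix m m ℂ → Matrix n n ℂ) : Prop :=
  ∃ (r : ℕ) (K : Fin r → Matrix n m ℂ),
    ∑ i, (K i)ᴴ * K i = 1 ∧ ∀ ρ, Φ ρ = ∑ i, K i * ρ * (K i)ᴴ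

/-- The set `B` of players can recover a quantum secret from the QQ encoding: one quantum channel,
acting on the qudits of `B` only and independent of the secret, maps the reduced state of `B` to
the secret, for every pure secret state `|φ⟩ = ∑_j s_j |j⟩` of one qudit. -/
def CanRecoverQuantumSecret {q : ℕ} [NeZero q] {V : Type*} [Fintype V] [DecidableEq V]
    (G : QMultigraph q V) (d : V) (B : Finset {v : V // v ≠ d}) : Prop :=
  ∃ Φ : Matrix ({w // w ∈ B} → ZMod q) ({w // w ∈ B} → ZMod q) ℂ → Matrix (ZMod q) (ZMod q) ℂ,
    IsQuantumChannel Φ ∧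
      ∀ s : ZMod q → ℂ, ∑ j, ‖s j‖ ^ 2 = 1 →
        Φ (reducedDensity B (pureDensity (qqEncode G d s))) = pureDensity s

end

section LinearAlgebra

variable {K m n : Type*} [Field K] [Fintype m]

lemma vecMul_mem_span_row (M : Matrix m n K) (v : n → K) :
    v ∈ Submodule.span K (Set.range M.row) ↔ ∃ a, a ᵥ* M = v := by
  rw [← range_vecMulLinear]
  rfl

lemma exists_mulVec_eq_zero_of_not_exists_vecMul [Fintype n] (M : Matrix m n K) (v : n → K)
    (h : ¬ ∃ a, a ᵥ* M = v) : ∃ u, M *ᵥ u = 0 ∧ v ⬝ᵥ u = 1 := by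
  classical
  rw [← vecMul_mem_span_row] at h
  obtain ⟨f, hfv, hf⟩ := Submodule.exists_le_ker_of_notMem h
  have hfe : ∀ w : n → K, f w = w ⬝ᵥ fun i => f (Pi.single i 1) := fun w => by
    conv_lhs => rw [pi_eq_sum_univ' w]
    simp [dotProduct]
  have hfM : M *ᵥ (fun i => f (Pi.single i 1)) = 0 := by
    ext i
    exact (hfe _).symm.trans (hf (Submodule.subset_span ⟨i, rfl⟩))
  refine ⟨(f v)⁻¹ • fun i => f (Pi.single i 1), ?_, ?_⟩
  · rw [Matrix.mulVec_smul, hfM, smul_zero]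
  · rw [dotProduct_smul, ← hfe, smul_eq_mul, inv_mul_cancel₀ hfv]

/-- The rank of a matrix with one distinguished row. -/
lemma rank_option_row [Fintype n] (A : Matrix (Option m) n K) (M : Matrix m n K)
    (hM : ∀ i, A (some i) = M i) [Decidable (∃ a, a ᵥ* M = A none)] :
    A.rank = M.rank + if ∃ a, a ᵥ* M = A none then 0 else 1 := by
  have hspan : Submodule.span K (Set.range A.row)
      = Submodule.span K (Set.range M.row) ⊔ Submodule.span K {A none} := by
    rw [← Submodule.span_union]
    congr 1
    ext v
    change (∃ o, A o = v) ↔ (∃ i, M i = v) ∨ v = A none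
    simp [Option.exists, hM, eq_comm, or_comm]
  rw [Matrix.rank_eq_finrank_span_row, Matrix.rank_eq_finrank_span_row, hspan]
  split_ifs with h
  · rw [← vecMul_mem_span_row] at h
    rw [sup_eq_left.2 ((Submodule.span_singleton_le_iff_mem _ _).2 h), add_zero]
  · rw [← vecMul_mem_span_row] at h
    exact Submodule.finrank_sup_span_singleton h

end LinearAlgebra

section EdgeCount

lemma Sym2.sum_lift_add_swap {α R : Type*} [Fintype α] [DecidableEq α] [AddCommMonoid R]
    (f : α → α → R) (hf : ∀ u, f u u = 0) :
    ∑ e : Sym2 α, Sym2.lift ⟨fun u v => f u v + f v u, fun _ _ => add_comm _ _⟩ e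
      = ∑ u, ∑ v, f u v := by
  rw [← Fintype.sum_prod_type' (f := f),
    ← Finset.sum_fiberwise (s := Finset.univ) (fun p : α × α => s(p.1, p.2))]
  refine Finset.sum_congr rfl fun e _ => ?_
  induction e with | _ u v
  by_cases huv : u = v
  · subst huv
    have : (Finset.univ.filter fun p : α × α => s(p.1, p.2) = s(u, u)) = {(u, u)} := by
      ext ⟨a, b⟩
      simp
    rw [this]
    simp [hf]
  · have : (Finset.univ.filter fun p : α × α => s(p.1, p.2) = s(u, v)) = {(u, v), (v, u)} := by
      ext ⟨a, b⟩
      simp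
    rw [this, Finset.sum_pair (by simp [huv])]
    rfl

lemma QMultigraph.edgeCount_add {q : ℕ} {V : Type*} [Fintype V] [DecidableEq V]
    (G : QMultigraph q V) (x y : V → ZMod q) :
    G.edgeCount (x + y) = G.edgeCount x + G.edgeCount y + y ⬝ᵥ G.Γ *ᵥ x := by
  have h := Sym2.sum_lift_add_swap (fun u v => y u * G.Γ u v * x v)
  have h2 : y ⬝ᵥ G.Γ *ᵥ x = ∑ u, ∑ v, y u * G.Γ u v * x v := by
    simp [dotProduct, Matrix.mulVec, Finset.mul_sum, mul_assoc]
  rw [h2, ← h (by simp [G.loopless]), edgeCount, edgeCount, edgeCount, ← Finset.sum_add_distrib,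
    ← Finset.sum_add_distrib]
  refine Finset.sum_congr rfl fun e _ => ?_
  induction e with | _ u v
  simp only [Sym2.lift_mk, Pi.add_apply, G.symm v u]
  ring

end EdgeCount

section CutRank

open scoped Classical in
lemma QMultigraph.dcutrk_eq_neg_one_iff {q : ℕ} [Fact q.Prime] {V : Type*} [Fintype V]
    [DecidableEq V] (G : QMultigraph q V) (d : V) (B : Finset V) (hB : d ∉ B)
    {β γ : Type*} [Fintype β] [Fintype γ] (eβ : β ≃ {v // v ∈ B})
    (eγ : γ ≃ {v // v ∈ (insert d B)ᶜ}) (M : Matrix γ β (ZMod q))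
    (hM : ∀ c b, M c b = G.Γ (eγ c) (eβ b)) :
    G.dcutrk d B = -1 ↔
      (∃ t, M *ᵥ t = fun c => G.Γ (eγ c) d) ∧ ¬ ∃ a, a ᵥ* M = fun b => G.Γ (eβ b) d := by
  let oβ : Option β ≃ {v // v ∈ insert d B} := Equiv.ofBijective
    (fun o => o.elim ⟨d, by simp⟩ fun b => ⟨eβ b, by simp⟩) (by
      constructor
      · rintro (_ | b) (_ | b') h
        · rfl
        · simp only [Option.elim, Subtype.mk.injEq] at h
          exact absurd (h ▸ (eβ b').2) hB
        · simp only [Option.elim, Subtype.mk.injEq] at h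
          exact absurd (h ▸ (eβ b).2) hB
        · simp only [Option.elim, Subtype.mk.injEq] at h
          rw [eβ.injective (Subtype.ext h)]
      · rintro ⟨v, hv⟩
        rcases Finset.mem_insert.1 hv with rfl | hv
        · exact ⟨none, rfl⟩
        · exact ⟨some (eβ.symm ⟨v, hv⟩), by simp⟩)
  let oγ : Option γ ≃ {v // v ∈ Bᶜ} := Equiv.ofBijective
    (fun o => o.elim ⟨d, by simpa using hB⟩ fun c => ⟨eγ c, by
      have := (eγ c).2
      simp only [Finset.mem_compl, Finset.mem_insert, not_or] at this ⊢
      exact this.2⟩) (by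
      have hd : ∀ c, (eγ c : V) ≠ d := fun c h => by
        have := (eγ c).2
        simp [h] at this
      constructor
      · rintro (_ | c) (_ | c') h
        · rfl
        · simp only [Option.elim, Subtype.mk.injEq] at h
          exact absurd h.symm (hd _)
        · simp only [Option.elim, Subtype.mk.injEq] at h
          exact absurd h (hd _)
        · simp only [Option.elim, Subtype.mk.injEq] at h
          rw [eγ.injective (Subtype.ext h)]
      · rintro ⟨v, hv⟩
        by_cases hvd : v = d
        · subst hvd
          exact ⟨none, rfl⟩
        · refine ⟨some (eγ.symm ⟨v, ?_⟩), by simp⟩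
          simpa [hvd] using hv)
  have h1 : G.cutrk B = M.rank + if ∃ a, a ᵥ* M = fun b => G.Γ (eβ b) d then 0 else 1 := by
    rw [QMultigraph.cutrk, QMultigraph.prk, ← Matrix.rank_submatrix _ oγ eβ,
      rank_option_row _ M]
    · congr 3
      ext a
      simp only [funext_iff, Matrix.submatrix_apply, G.symm _ d]
      rfl
    · intro i
      ext b
      exact (hM i b).symm
  have h2 : G.cutrk (insert d B)
      = M.rank + if ∃ t, M *ᵥ t = fun c => G.Γ (eγ c) d then 0 else 1 := by
    rw [QMultigraph.cutrk, QMultigraph.prk, ← Matrix.rank_submatrix _ eγ oβ,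
      ← Matrix.rank_transpose, rank_option_row _ Mᵀ, Matrix.rank_transpose]
    · congr 3
      ext a
      rw [Matrix.vecMul_transpose]
      rfl
    · intro i
      ext b
      exact (hM b i).symm
  rw [QMultigraph.dcutrk, h1, h2]
  by_cases ha : ∃ a, a ᵥ* M = fun b => G.Γ (eβ b) d <;>
    by_cases ht : ∃ t, M *ᵥ t = fun c => G.Γ (eγ c) d <;>
    simp only [ha, ht, if_true, if_false, not_true_eq_false, not_false_eq_true, and_true,
      and_false, iff_false, iff_true] <;> push_cast <;> omega

end CutRank

section Density

lemma mul_pureDensity_mul_conjTranspose {m n : Type*} [Fintype m] (K : Matrix n m ℂ) (v : m → ℂ) :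
    K * pureDensity v * Kᴴ = pureDensity (K *ᵥ v) := by
  rw [pureDensity, pureDensity, Matrix.mul_vecMulVec, Matrix.vecMulVec_mul, Matrix.star_mulVec]

lemma pureDensity_smul {n : Type*} (a : ℂ) (v : n → ℂ) :
    pureDensity (a • v) = (a * star a) • pureDensity v := by
  ext i j
  simp [pureDensity, Matrix.vecMulVec_apply]
  ring

/-- The reduction to `B` of a pure state is the mixture of its slices. -/
lemma reducedDensity_pureDensity {q : ℕ} [NeZero q] {W : Type*} [Fintype W] [DecidableEq W]
    (B : Finset W) (ψ : (W → ZMod q) → ℂ) :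
    reducedDensity B (pureDensity ψ) = ∑ z : {w // ¬ w ∈ B} → ZMod q,
      pureDensity fun x => ψ ((Equiv.piEquivPiSubtypeProd (fun w => w ∈ B)
        (fun _ => ZMod q)).symm (x, z)) := by
  ext x y
  rw [Matrix.sum_apply]
  rfl

end Density

section Bipartite

variable {q : ℕ} [Fact q.Prime] {β γ : Type*} [Fintype β] [Fintype γ]

/-- The unnormalised amplitudes of an encoded secret, with the players split into two parts `β`
and `γ`: `QB`, `QC` are the phases internal to the parts, `M` holds the edges between them, and
`DB`, `DC` are the edges to the dealer. -/
noncomputable def bipartiteAmplitude (QB : (β → ZMod q) → ZMod q) (QC : (γ → ZMod q) → ZMod q)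
    (M : Matrix γ β (ZMod q)) (DB : β → ZMod q) (DC : γ → ZMod q) (s : ZMod q → ℂ)
    (b : β → ZMod q) (c : γ → ZMod q) : ℂ :=
  ZMod.stdAddChar (QB b + QC c + c ⬝ᵥ M *ᵥ b)
    * ∑ j, s j * ZMod.stdAddChar (j * (DB ⬝ᵥ b + DC ⬝ᵥ c))

lemma stdAddChar_mul_star (x : ZMod q) :
    (ZMod.stdAddChar x : ℂ) * star (ZMod.stdAddChar x : ℂ) = 1 := by
  have h : (star (ZMod.stdAddChar x : ℂ)) = ZMod.stdAddChar (-x) :=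
    (AddChar.map_neg_eq_conj _ _).symm
  rw [h, ← AddChar.map_add_eq_mul, add_neg_cancel, AddChar.map_zero_eq_one]

lemma star_stdAddChar (x : ZMod q) :
    star (ZMod.stdAddChar x : ℂ) = ZMod.stdAddChar (-x) :=
  (AddChar.map_neg_eq_conj _ _).symm

lemma sum_stdAddChar_mul (x : ZMod q) :
    ∑ j : ZMod q, (ZMod.stdAddChar (j * x) : ℂ) = if x = 0 then (q : ℂ) else 0 := by
  rw [AddChar.sum_mulShift x (ZMod.isPrimitive_stdAddChar q), ZMod.card]
  split_ifs <;> simp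

/-- Two families of states that agree up to a translation and phases on the discarded part have
the same reduction. -/
lemma sum_pureDensity_eq_of_shift {β : Type*} [DecidableEq γ]
    (f g : (β → ZMod q) → (γ → ZMod q) → ℂ) (e : γ → ZMod q)
    (p : (γ → ZMod q) → ZMod q)
    (h : ∀ b c, g b c = ZMod.stdAddChar (p c) * f b (c + e)) :
    ∑ c, pureDensity (fun b => g b c) = ∑ c, pureDensity (fun b => f b c) := by
  rw [← Equiv.sum_comp (Equiv.addRight e) (fun c => pureDensity (fun b => f b c))]
  refine Finset.sum_congr rfl fun c _ => ?_
  have : (fun b => g b c) = (ZMod.stdAddChar (p c) : ℂ) • fun b => f b (c + e) := by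
    ext b
    exact h b c
  rw [this, pureDensity_smul, stdAddChar_mul_star, one_smul]
  rfl

variable (QB : (β → ZMod q) → ZMod q) (QC : (γ → ZMod q) → ZMod q)
  (M : Matrix γ β (ZMod q)) (DB : β → ZMod q) (DC : γ → ZMod q)

lemma sum_pureDensity_bipartiteAmplitude_phase [DecidableEq γ] (a : γ → ZMod q) (ha : a ᵥ* M = 0)
    (haD : DC ⬝ᵥ a = 1) (s : ZMod q → ℂ) :
    ∑ c, pureDensity (fun b => bipartiteAmplitude QB QC M DB DC
        (fun j => ZMod.stdAddChar j * s j) b c)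
      = ∑ c, pureDensity (fun b => bipartiteAmplitude QB QC M DB DC s b c) := by
  refine sum_pureDensity_eq_of_shift _ _ a (fun c => QC c - QC (c + a)) fun b c => ?_
  simp only [bipartiteAmplitude, dotProduct_add, add_dotProduct, haD]
  rw [Matrix.dotProduct_mulVec a, ha, zero_dotProduct, ← mul_assoc, ← AddChar.map_add_eq_mul]
  congr 1
  · congr 1
    ring
  · refine Finset.sum_congr rfl fun j _ => ?_
    rw [mul_comm (ZMod.stdAddChar j : ℂ), mul_assoc, ← AddChar.map_add_eq_mul]
    congr 2
    ring

lemma sum_pureDensity_bipartiteAmplitude_single [DecidableEq γ] (a : γ → ZMod q) (ha : a ᵥ* M = DB) :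
    ∑ c, pureDensity (fun b => bipartiteAmplitude QB QC M DB DC (Pi.single 1 1) b c)
      = ∑ c, pureDensity (fun b => bipartiteAmplitude QB QC M DB DC (Pi.single 0 1) b c) := by
  refine sum_pureDensity_eq_of_shift _ _ a (fun c => QC c - QC (c + a) + DC ⬝ᵥ c) fun b c => ?_
  simp only [bipartiteAmplitude, Pi.single_apply, ite_mul, zero_mul, one_mul, Finset.sum_ite_eq',
    Finset.mem_univ, if_true, add_dotProduct, AddChar.map_zero_eq_one, mul_one,
    Matrix.dotProduct_mulVec a, ha, ← AddChar.map_add_eq_mul]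
  congr 1
  ring

/-- The Kraus operators, indexed by `x`, of the decoding channel: `u` is the direction of the
logical phase operator, `t` that of the logical shift operator. -/
noncomputable def decodingKraus [DecidableEq β] (u t x : β → ZMod q) : Matrix (ZMod q) (β → ZMod q) ℂ :=
  fun j b => (q : ℂ)⁻¹ * ∑ r : ZMod q, if b = x + r • u - j • t then
    ZMod.stdAddChar (-QB b - j * (DB ⬝ᵥ b)) else 0

lemma decodingKraus_mulVec [DecidableEq β] (u t x : β → ZMod q) (f : (β → ZMod q) → ℂ) (j : ZMod q) :
    (decodingKraus QB DB u t x *ᵥ f) j = (q : ℂ)⁻¹ * ∑ r : ZMod q,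
      ZMod.stdAddChar (-QB (x + r • u - j • t) - j * (DB ⬝ᵥ (x + r • u - j • t)))
        * f (x + r • u - j • t) := by
  simp only [Matrix.mulVec, dotProduct, decodingKraus, mul_assoc, Finset.sum_mul, ite_mul, zero_mul]
  rw [← Finset.mul_sum, Finset.sum_comm]
  simp

lemma decodingKraus_mulVec_bipartiteAmplitude [DecidableEq β] (u t x : β → ZMod q) (hu : M *ᵥ u = 0)
    (hDu : DB ⬝ᵥ u = 1) (ht : M *ᵥ t = DC) (s : ZMod q → ℂ) (c : γ → ZMod q) :
    (decodingKraus QB DB u t x *ᵥ fun b => bipartiteAmplitude QB QC M DB DC s b c)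
      = (ZMod.stdAddChar (QC c + c ⬝ᵥ M *ᵥ x) : ℂ) • s := by
  ext j
  have hq : (q : ℂ) ≠ 0 := NeZero.ne _
  rw [decodingKraus_mulVec]
  have h : ∀ r : ZMod q,
      ZMod.stdAddChar (-QB (x + r • u - j • t) - j * (DB ⬝ᵥ (x + r • u - j • t)))
        * bipartiteAmplitude QB QC M DB DC s (x + r • u - j • t) c
      = ∑ l, ZMod.stdAddChar (QC c + c ⬝ᵥ M *ᵥ x + (l - j) * (DB ⬝ᵥ x - j * (DB ⬝ᵥ t))
          + (l - j) * (DC ⬝ᵥ c)) * s l * ZMod.stdAddChar (r * (l - j)) := fun r => by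
    rw [bipartiteAmplitude, ← mul_assoc, ← AddChar.map_add_eq_mul, Finset.mul_sum]
    refine Finset.sum_congr rfl fun l _ => ?_
    rw [mul_comm (s l), ← mul_assoc, mul_right_comm _ (s l), ← AddChar.map_add_eq_mul,
      ← AddChar.map_add_eq_mul]
    congr 2
    simp only [Matrix.mulVec_add, Matrix.mulVec_sub, Matrix.mulVec_smul, hu, ht, dotProduct_add,
      dotProduct_sub, dotProduct_smul, hDu, smul_eq_mul, dotProduct_zero, dotProduct_comm c DC]
    ring
  simp_rw [h]
  rw [Finset.sum_comm]
  simp_rw [← Finset.mul_sum, sum_stdAddChar_mul, sub_eq_zero]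
  simp
  field_simp

lemma sum_conjTranspose_decodingKraus_mul [DecidableEq β] (u t : β → ZMod q)
    (hDu : DB ⬝ᵥ u = 1) :
    ∑ x, (decodingKraus QB DB u t x)ᴴ * decodingKraus QB DB u t x = 1 := by
  have hq : (q : ℂ) ≠ 0 := NeZero.ne _
  ext b b'
  rw [Matrix.sum_apply]
  simp only [Matrix.mul_apply, Matrix.conjTranspose_apply]
  rw [Finset.sum_comm]
  have h : ∀ j : ZMod q, ∑ x, star (decodingKraus QB DB u t x j b) * decodingKraus QB DB u t x j b'
      = (q : ℂ)⁻¹ * ∑ r : ZMod q, if b' = b + r • u then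
        ZMod.stdAddChar (QB b - QB b') * ZMod.stdAddChar (j * (-r)) else 0 := fun j => by
    have h1 : ∀ x, star (decodingKraus QB DB u t x j b) = (q : ℂ)⁻¹ * ∑ r : ZMod q,
        if x = b - r • u + j • t then ZMod.stdAddChar (QB b + j * (DB ⬝ᵥ b)) else 0 := fun x => by
      simp only [decodingKraus, star_mul', star_sum, apply_ite star, star_zero, star_stdAddChar,
        star_inv₀, star_natCast]
      congr 1
      refine Finset.sum_congr rfl fun r _ => if_congr ?_ ?_ rfl
      · constructor <;> rintro rfl <;> abel
      · congr 1
        ring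
    simp_rw [h1, mul_assoc, Finset.sum_mul, ite_mul, zero_mul]
    rw [← Finset.mul_sum, Finset.sum_comm]
    simp only [Finset.sum_ite_eq', Finset.mem_univ, if_true]
    congr 1
    have h2 : ∀ r : ZMod q, ZMod.stdAddChar (QB b + j * (DB ⬝ᵥ b))
        * decodingKraus QB DB u t (b - r • u + j • t) j b'
        = (q : ℂ)⁻¹ * ∑ r : ZMod q, if b' = b + r • u then
          ZMod.stdAddChar (QB b - QB b') * ZMod.stdAddChar (j * (-r)) else 0 := fun r => by
      rw [decodingKraus, mul_left_comm, Finset.mul_sum,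
        ← Equiv.sum_comp (Equiv.addRight r)]
      congr 1
      refine Finset.sum_congr rfl fun k _ => ?_
      have h3 : b - r • u + j • t + (Equiv.addRight r) k • u - j • t = b + k • u := by
        rw [Equiv.coe_addRight, add_smul]
        abel
      rw [h3, mul_ite, mul_zero]
      refine if_ctx_congr Iff.rfl (fun hb => ?_) fun _ => rfl
      rw [← AddChar.map_add_eq_mul, ← AddChar.map_add_eq_mul]
      congr 1
      rw [hb, dotProduct_add, dotProduct_smul, hDu, smul_eq_mul]
      ring
    simp_rw [h2]
    rw [Finset.sum_const, Finset.card_univ, ZMod.card, nsmul_eq_mul, ← mul_assoc,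
      mul_inv_cancel₀ hq, one_mul]
  simp_rw [h]
  rw [← Finset.mul_sum, Finset.sum_comm]
  have h4 : ∀ r : ZMod q, (∑ j : ZMod q, if b' = b + r • u then
        (ZMod.stdAddChar (QB b - QB b') : ℂ) * ZMod.stdAddChar (j * (-r)) else 0)
      = if r = 0 then (if b' = b then (q : ℂ) else 0) else 0 := fun r => by
    rw [Finset.sum_ite_irrel, ← Finset.mul_sum, sum_stdAddChar_mul]
    by_cases hr : r = 0
    · subst hr
      by_cases hb : b' = b <;> simp [hb]
    · simp [hr]
  simp_rw [h4]
  rw [Finset.sum_ite_eq' , if_pos (Finset.mem_univ _), Matrix.one_apply]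
  simp only [eq_comm (a := b')]
  split_ifs <;> simp [hq]

end Bipartite

section Encoding

variable {q : ℕ} [Fact q.Prime] {V : Type*} [Fintype V] [DecidableEq V]

/-- The normalisation constant `q^{-n/2}` of a graph state on `n` qudits. -/
noncomputable def graphStateNorm (q n : ℕ) : ℂ := ((1 / Real.sqrt ((q : ℝ) ^ n) : ℝ) : ℂ)

lemma graphStateNorm_mul_star (n : ℕ) :
    graphStateNorm q n * star (graphStateNorm q n) * (q : ℂ) ^ n = 1 := by
  have hq : (0 : ℝ) < (q : ℝ) ^ n := pow_pos (Nat.cast_pos.2 (NeZero.pos q)) n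
  have h : star (graphStateNorm q n) = graphStateNorm q n := Complex.conj_ofReal _
  rw [h, graphStateNorm, ← Complex.ofReal_mul, div_mul_div_comm, Real.mul_self_sqrt hq.le]
  push_cast
  have : (q : ℂ) ^ n ≠ 0 := pow_ne_zero _ (NeZero.ne _)
  field_simp

lemma graphStateNorm_ne_zero (n : ℕ) : graphStateNorm q n ≠ 0 := fun h => by
  have := graphStateNorm_mul_star (q := q) n
  simp [h] at this

lemma qqEncode_apply (G : QMultigraph q V) (d : V) (s : ZMod q → ℂ)
    (x : {v : V // v ≠ d} → ZMod q) :
    qqEncode G d s x = graphStateNorm q (Fintype.card {v : V // v ≠ d})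
      * (ZMod.stdAddChar ((G.delete d).edgeCount x)
        * ∑ j, s j * ZMod.stdAddChar (j * ∑ v : {v : V // v ≠ d}, G.Γ v d * x v)) := by
  rw [qqEncode, Finset.sum_apply, Finset.mul_sum, Finset.mul_sum]
  refine Finset.sum_congr rfl fun j _ => ?_
  rw [Pi.smul_apply, encodedBasis, pauliZ, Matrix.diagonal_pow, Matrix.mulVec_diagonal,
    QMultigraph.graphState, Pi.pow_apply, ← AddChar.map_nsmul_eq_pow, nsmul_eq_mul,
    ZMod.natCast_zmod_val, smul_eq_mul, graphStateNorm]
  ring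

/-- The adjacency matrix between the players outside `B` and those in `B`. -/
def crossMatrix (G : QMultigraph q V) (d : V) (B : Finset {v : V // v ≠ d}) :
    Matrix {w // ¬ w ∈ B} {w // w ∈ B} (ZMod q) :=
  fun c b => G.Γ c b

lemma exists_qqEncode_eq_bipartiteAmplitude (G : QMultigraph q V) (d : V)
    (B : Finset {v : V // v ≠ d}) : ∃ QB QC, ∀ s b c,
    qqEncode G d s ((Equiv.piEquivPiSubtypeProd (fun w => w ∈ B) (fun _ => ZMod q)).symm (b, c))
      = graphStateNorm q (Fintype.card {v : V // v ≠ d})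
        * bipartiteAmplitude QB QC (crossMatrix G d B) (fun b => G.Γ b d) (fun c => G.Γ c d)
          s b c := by
  let e := Equiv.piEquivPiSubtypeProd (fun w : {v : V // v ≠ d} => w ∈ B) (fun _ => ZMod q)
  have hsplit : ∀ b c, e.symm (b, c) = e.symm (b, 0) + e.symm (0, c) := fun b c => by
    ext w
    by_cases hw : w ∈ B <;> simp [e, Equiv.piEquivPiSubtypeProd, hw]
  have hsum : ∀ (f : {v : V // v ≠ d} → ZMod q) b c,
      ∑ w, f w * e.symm (b, c) w = ∑ w : {w // w ∈ B}, f w * b w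
        + ∑ w : {w // ¬ w ∈ B}, f w * c w := fun f b c => by
    rw [← Fintype.sum_subtype_add_sum_subtype (fun w => w ∈ B)]
    congr 1 <;> refine Finset.sum_congr (by ext; simp) fun w _ => ?_
    · simp [e, Equiv.piEquivPiSubtypeProd, w.2]
    · simp [e, Equiv.piEquivPiSubtypeProd, w.2]
  refine ⟨fun b => (G.delete d).edgeCount (e.symm (b, 0)),
    fun c => (G.delete d).edgeCount (e.symm (0, c)), fun s b c => ?_⟩
  change qqEncode G d s (e.symm (b, c)) = _
  rw [qqEncode_apply, bipartiteAmplitude, hsum]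
  congr 3
  rw [hsplit, QMultigraph.edgeCount_add]
  congr 1
  rw [dotProduct_comm, dotProduct, hsum]
  simp only [Pi.zero_apply, mul_zero, Finset.sum_const_zero, zero_add]
  rw [dotProduct_comm c]
  refine Finset.sum_congr rfl fun w _ => ?_
  congr 1
  rw [Matrix.mulVec, dotProduct, hsum]
  simp only [Pi.zero_apply, mul_zero, Finset.sum_const_zero, add_zero]
  rfl

end Encoding

section Recovery

variable {q : ℕ} [Fact q.Prime] {V : Type*} [Fintype V] [DecidableEq V]

lemma reducedDensity_qqEncode (G : QMultigraph q V) (d : V) (B : Finset {v : V // v ≠ d}) :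
    ∃ QB QC, ∀ s, reducedDensity B (pureDensity (qqEncode G d s))
      = (graphStateNorm q (Fintype.card {v : V // v ≠ d})
          * star (graphStateNorm q (Fintype.card {v : V // v ≠ d}))) •
        ∑ c, pureDensity (fun b => bipartiteAmplitude QB QC (crossMatrix G d B)
          (fun b => G.Γ b d) (fun c => G.Γ c d) s b c) := by
  obtain ⟨QB, QC, h⟩ := exists_qqEncode_eq_bipartiteAmplitude G d B
  refine ⟨QB, QC, fun s => ?_⟩
  rw [reducedDensity_pureDensity, Finset.smul_sum]
  refine Finset.sum_congr rfl fun c _ => ?_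
  rw [← pureDensity_smul]
  congr 1
  ext b
  exact h s b c

lemma canRecoverQuantumSecret_of_mulVec_eq (G : QMultigraph q V) (d : V)
    (B : Finset {v : V // v ≠ d}) (u t : {w // w ∈ B} → ZMod q)
    (hu : crossMatrix G d B *ᵥ u = 0) (hDu : (fun b : {w // w ∈ B} => G.Γ b d) ⬝ᵥ u = 1)
    (ht : crossMatrix G d B *ᵥ t = fun c : {w // ¬ w ∈ B} => G.Γ c d) : CanRecoverQuantumSecret G d B := by
  obtain ⟨QB, QC, h⟩ := reducedDensity_qqEncode G d B
  set DB : {w // w ∈ B} → ZMod q := fun b => G.Γ b d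
  let eβ := Fintype.equivFin ({w // w ∈ B} → ZMod q)
  refine ⟨fun ρ => ∑ x, decodingKraus QB DB u t x * ρ * (decodingKraus QB DB u t x)ᴴ,
    ⟨_, fun i => decodingKraus QB DB u t (eβ.symm i), ?_, fun ρ => ?_⟩, fun s _ => ?_⟩
  · rw [Equiv.sum_comp eβ.symm
      (fun x => (decodingKraus QB DB u t x)ᴴ * decodingKraus QB DB u t x)]
    exact sum_conjTranspose_decodingKraus_mul QB DB u t hDu
  · exact (Equiv.sum_comp eβ.symm
      (fun x => decodingKraus QB DB u t x * ρ * (decodingKraus QB DB u t x)ᴴ)).symm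
  · have hcard : (Fintype.card ({w // w ∈ B} → ZMod q) : ℂ)
        * Fintype.card ({w // ¬ w ∈ B} → ZMod q) = q ^ Fintype.card {v : V // v ≠ d} := by
      rw [← Nat.cast_mul, ← Fintype.card_prod, ← Fintype.card_congr
        (Equiv.piEquivPiSubtypeProd (fun w : {v : V // v ≠ d} => w ∈ B) (fun _ => ZMod q)),
        Fintype.card_fun, ZMod.card, Nat.cast_pow]
    simp only [h, Matrix.mul_smul, Matrix.smul_mul, Matrix.mul_sum, Matrix.sum_mul,
      mul_pureDensity_mul_conjTranspose,
      decodingKraus_mulVec_bipartiteAmplitude QB QC _ DB _ u t _ hu hDu ht, pureDensity_smul,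
      stdAddChar_mul_star, one_smul, Finset.sum_const, Finset.card_univ]
    rw [← Nat.cast_smul_eq_nsmul ℂ, ← Nat.cast_smul_eq_nsmul ℂ, smul_smul, smul_smul,
      mul_right_comm, hcard, mul_comm, graphStateNorm_mul_star, one_smul]

lemma CanRecoverQuantumSecret.pureDensity_eq {G : QMultigraph q V} {d : V}
    {B : Finset {v : V // v ≠ d}} (hrec : CanRecoverQuantumSecret G d B) (s s' : ZMod q → ℂ)
    (hs : ∑ j, ‖s j‖ ^ 2 = 1) (hs' : ∑ j, ‖s' j‖ ^ 2 = 1)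
    (h : reducedDensity B (pureDensity (qqEncode G d s))
      = reducedDensity B (pureDensity (qqEncode G d s'))) : pureDensity s = pureDensity s' := by
  obtain ⟨Φ, -, hΦ⟩ := hrec
  rw [← hΦ s hs, h, hΦ s' hs']

lemma CanRecoverQuantumSecret.exists_mulVec_eq {G : QMultigraph q V} {d : V}
    {B : Finset {v : V // v ≠ d}} (hrec : CanRecoverQuantumSecret G d B) :
    ∃ t, crossMatrix G d B *ᵥ t = fun c : {w // ¬ w ∈ B} => G.Γ c d := by
  by_contra hcon
  obtain ⟨a, ha, haD⟩ := exists_mulVec_eq_zero_of_not_exists_vecMul (crossMatrix G d B)ᵀ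
    (fun c : {w // ¬ w ∈ B} => G.Γ c d) (by simpa only [Matrix.vecMul_transpose] using hcon)
  rw [Matrix.mulVec_transpose] at ha
  obtain ⟨QB, QC, h⟩ := reducedDensity_qqEncode G d B
  have hq : (0 : ℝ) < q := Nat.cast_pos.2 (NeZero.pos q)
  have hns : ∑ _j : ZMod q, ‖graphStateNorm q 1‖ ^ 2 = 1 := by
    rw [graphStateNorm, Complex.norm_real, Real.norm_eq_abs, sq_abs, div_pow,
      Real.sq_sqrt (by positivity), Finset.sum_const, Finset.card_univ, ZMod.card]
    simp [hq.ne']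
  have hχ : ∀ j : ZMod q, ‖(ZMod.stdAddChar j : ℂ)‖ = 1 := fun j => by
    rw [ZMod.stdAddChar_apply, Circle.norm_coe]
  have key := hrec.pureDensity_eq (fun j => ZMod.stdAddChar j * graphStateNorm q 1)
    (fun _ => graphStateNorm q 1) (by simpa only [norm_mul, hχ, one_mul] using hns) hns (by
      rw [h, h, sum_pureDensity_bipartiteAmplitude_phase QB QC _ _ _ a ha haD])
  have h10 := congrFun (congrFun key 1) 0
  have h0 := graphStateNorm_ne_zero (q := q) 1
  simp only [pureDensity, Matrix.vecMulVec_apply, Pi.star_apply, AddChar.map_zero_eq_one, one_mul]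
    at h10
  rw [mul_assoc, mul_eq_right₀ (mul_ne_zero h0 (star_ne_zero.2 h0)),
    ← AddChar.map_zero_eq_one (ZMod.stdAddChar (N := q))] at h10
  exact one_ne_zero (ZMod.injective_stdAddChar h10)

lemma CanRecoverQuantumSecret.not_exists_vecMul_eq {G : QMultigraph q V} {d : V}
    {B : Finset {v : V // v ≠ d}} (hrec : CanRecoverQuantumSecret G d B) :
    ¬ ∃ a, a ᵥ* crossMatrix G d B = fun b : {w // w ∈ B} => G.Γ b d := by
  rintro ⟨a, ha⟩
  obtain ⟨QB, QC, h⟩ := reducedDensity_qqEncode G d B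
  have hns : ∀ k : ZMod q, ∑ j, ‖(Pi.single k 1 : ZMod q → ℂ) j‖ ^ 2 = 1 := fun k => by
    rw [Finset.sum_eq_single k (fun j _ hj => by simp [hj]) (by simp)]
    simp
  have key := hrec.pureDensity_eq (Pi.single 1 1) (Pi.single 0 1) (hns 1) (hns 0) (by
      rw [h, h, sum_pureDensity_bipartiteAmplitude_single QB QC _ _ _ a ha])
  have h00 := congrFun (congrFun key 0) 0
  simp [pureDensity, Matrix.vecMulVec_apply] at h00

end Recovery

theorem theorem3p1 (q : ℕ) [Fact q.Prime] {V : Type*} [Fintype V] [DecidableEq V]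
    (G : QMultigraph q V) (d : V) (B : Finset V) (hB : d ∉ B) :
    CanRecoverQuantumSecret G d (B.subtype (fun v => v ≠ d)) ↔ G.dcutrk d B = -1 := by
  have hne : ∀ v ∈ B, v ≠ d := fun v hv h => hB (h ▸ hv)
  let eβ : {w // w ∈ B.subtype (fun v => v ≠ d)} ≃ {v // v ∈ B} :=
    { toFun := fun w => ⟨w, Finset.mem_subtype.1 w.2⟩
      invFun := fun v => ⟨⟨v, hne v v.2⟩, Finset.mem_subtype.2 v.2⟩
      left_inv := fun _ => rfl
      right_inv := fun _ => rfl }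
  let eγ : {w // ¬ w ∈ B.subtype (fun v => v ≠ d)} ≃ {v // v ∈ (insert d B)ᶜ} :=
    { toFun := fun w => ⟨w, by
        have h1 := w.2
        have h2 := w.1.2
        simp only [Finset.mem_subtype] at h1
        simp [h1, h2]⟩
      invFun := fun v => ⟨⟨v, fun h => by simpa [h] using v.2⟩, fun h => by
        have h1 := v.2
        rw [Finset.mem_subtype] at h
        simp [h] at h1⟩
      left_inv := fun _ => rfl
      right_inv := fun _ => rfl }
  rw [G.dcutrk_eq_neg_one_iff d B hB eβ eγ (crossMatrix G d _) (fun _ _ => rfl)]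
  constructor
  · exact fun h => ⟨h.exists_mulVec_eq, h.not_exists_vecMul_eq⟩
  · rintro ⟨⟨t, ht⟩, ha⟩
    obtain ⟨u, hu, hDu⟩ := exists_mulVec_eq_zero_of_not_exists_vecMul _ _ ha
    exact canRecoverQuantumSecret_of_mulVec_eq G d _ u t hu hDu ht
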